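/- Let $G=(V,E)$ be a finite connected graph with at least two vertices. The *choice random walk* (CRW) on $G$ is the process $(X_t)_{t\ge 0}$ on $V$ with a fixed starting vertex in which, at each time $t$, a controller is offered two vertices $c_1^t,c_2^t$, chosen independently and uniformly at random (with repetition) from the neighbours of $X_t$, and selects one of them as $X_{t+1}$. A *strategy* is a rule for the selection, which may depend on $t$, on the whole history $(X_i,c_1^i,c_2^i)_{0\le i\le t}$ and on additional random bits. For $x,y\in V$ let $H_x(y)$ be the infimum over all strategies of the expected first time at which the CRW started at $x$ is at $y$, and let $C_v$ be the infimum over all strategies of the expected first time by which the CRW started at $v$ has visited every vertex. The optimal *hitting time* of $G$ is $t_{\mathrm{hit}}(G)=\max_{x,y\in V}H_x(y)$ and the optimal *cover time* is $t_{\mathrm{cov}}(G)=\max_{v\in V}C_v$. **Theorem.** For every integer $d\ge 1$ there are constants $0<c\le C<\infty$, depending only on $d$, such that for every integer $k\ge 2$, if $G$ is either the discrete torus $\mathbb Z_k^d$ (the $d$-fold Cartesian power of the cycle on $k$ vertices, where for $k=2$ the cycle is a single edge) or the grid $[k]^d$ (the $d$-fold Cartesian power of the path on $k$ vertices), and $n=k^d$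 is its number of vertices, then $$c\,n\le t_{\mathrm{cov}}(G)\le C\,n,\qquad c\,k\le t_{\mathrm{hit}}(G)\le C\,k,$$ and in particular $t_{\mathrm{hit}}(G)\le C\,n^{1/d}$. -/

import Mathlib

open MeasureTheory ProbabilityTheory
open scoped ENNReal NNReal

namespace ChoiceWalk

/-- What the controller sees at one time step: the current position of the walk and the two
offered vertices. -/
@[ext]
structure Obs (V : Type*) where
  pos : V
  c₁ : V
  c₂ : V

instance (V : Type*) : MeasurableSpace (Obs V) := ⊤

instance (V : Type*) : DiscreteMeasurableSpace (Obs V) := ⟨fun _ => trivial⟩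

instance (V : Type*) [Finite V] : Finite (Obs V) :=
  Finite.of_injective (fun o : Obs V => (o.pos, o.c₁, o.c₂)) (by
    rintro ⟨a, b, c⟩ ⟨a', b', c'⟩ h
    simpa using h)

/-- The history `(X_i, c₁^i, c₂^i)_{i ≤ t}` of the process up to and including time `t`. -/
abbrev History (V : Type*) (t : ℕ) : Type _ := (i : Finset.Iic t) → Obs V

/-- The most recent observation `(X_t, c₁^t, c₂^t)` of a history. -/
def History.last {V : Type*} {t : ℕ} (h : History V t) : Obs V :=
  h ⟨t, Finset.mem_Iic.2 le_rfl⟩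

/-- A (possibly randomised, time- and history-dependent) strategy of the controller: for every
time `t` and every history up to time `t`, the current offer included, the distribution of the
controller's answer: `true` accepts the first offered vertex `c₁^t`, `false` the second, `c₂^t`.
Deterministic strategies are those that use point masses only. -/
abbrev Strategy (V : Type*) : Type _ := (t : ℕ) → History V t → PMF Bool

noncomputable section

variable {V : Type*} [Fintype V]

open Classical in
/-- A uniformly random neighbour of `v`. (At an isolated vertex, where there is no neighbour, the
convention is that the walk stays put.) -/
def randomNeighbour (G : SimpleGraph V) (v : V) : PMF V :=
  if h : (Finset.univ.filter (G.Adj v)).Nonempty then PMF.uniformOfFinset _ h else PMF.pure v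

/-- The walk is at `v` and is offered two independent uniformly random neighbours of `v`, with
replacement. -/
def offerAt (G : SimpleGraph V) (v : V) : PMF (Obs V) :=
  (randomNeighbour G v).bind fun a => (randomNeighbour G v).map fun b => ⟨v, a, b⟩

/-- The law of the next position given the history. -/
def nextPos (σ : Strategy V) (t : ℕ) (h : History V t) : PMF V :=
  (σ t h).map fun acceptFirst => cond acceptFirst h.last.c₁ h.last.c₂

/-- The law of the next observation given the history: the controller moves the walk to one of the
two offered vertices, and is then offered two random neighbours of the new position. -/
def nextObs (G : SimpleGraph V) (σ : Strategy V) (t : ℕ) (h : History V t) : PMF (Obs V) :=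
  (nextPos σ t h).bind (offerAt G)

/-- `nextObs` as a transition kernel from histories to observations. -/
def stepKernel (G : SimpleGraph V) (σ : Strategy V) (t : ℕ) :
    Kernel (History V t) (Obs V) where
  toFun h := (nextObs G σ t h).toMeasure
  measurable' := Measurable.of_discrete

instance (G : SimpleGraph V) (σ : Strategy V) (t : ℕ) : IsMarkovKernel (stepKernel G σ t) :=
  ⟨fun h => inferInstanceAs (IsProbabilityMeasure (nextObs G σ t h).toMeasure)⟩

/-- The law, on infinite trajectories, of the choice random walk on `G` started at `v` and
controlled by the strategy `σ`. -/
def law (G : SimpleGraph V) (σ : Strategy V) (v : V) : Measure (ℕ → Obs V) :=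
  Kernel.trajMeasure (X := fun _ => Obs V) (offerAt G v).toMeasure (stepKernel G σ)

/-- The first time at which a trajectory is at `y` (`∞` if it never is). -/
def timeToHit (y : V) (ω : ℕ → Obs V) : ℝ≥0∞ :=
  ⨅ (t : ℕ) (_ : (ω t).pos = y), (t : ℝ≥0∞)

/-- The first time by which a trajectory has visited every vertex (`∞` if there is none). -/
def timeToCover (ω : ℕ → Obs V) : ℝ≥0∞ :=
  ⨅ (t : ℕ) (_ : ∀ y : V, ∃ s ≤ t, (ω s).pos = y), (t : ℝ≥0∞)

/-- The optimal expected time for the choice random walk started at `x` to reach `y`. -/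
def hittingTimeFrom (G : SimpleGraph V) (x y : V) : ℝ≥0∞ :=
  ⨅ σ : Strategy V, ∫⁻ ω, timeToHit y ω ∂(law G σ x)

/-- The optimal expected time for the choice random walk started at `v` to visit all vertices. -/
def coverTimeFrom (G : SimpleGraph V) (v : V) : ℝ≥0∞ :=
  ⨅ σ : Strategy V, ∫⁻ ω, timeToCover ω ∂(law G σ v)

/-- The hitting time of the choice random walk on `G`: the worst case over start and target. -/
def hittingTime (G : SimpleGraph V) : ℝ≥0∞ := ⨆ (x : V) (y : V), hittingTimeFrom G x y

/-- The cover time of the choice random walk on `G`: the worst case over the start. -/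
def coverTime (G : SimpleGraph V) : ℝ≥0∞ := ⨆ v : V, coverTimeFrom G v

end

/-- The `d`-fold Cartesian (box) power of a graph: two vertices are adjacent when they differ in
exactly one coordinate and are adjacent in that coordinate. -/
def boxPower {α : Type*} (H : SimpleGraph α) (d : ℕ) : SimpleGraph (Fin d → α) where
  Adj x y := ∃ i, H.Adj (x i) (y i) ∧ ∀ j, j ≠ i → x j = y j
  symm := ⟨fun _ _ ⟨i, h, h'⟩ => ⟨i, h.symm, fun j hj => (h' j hj).symm⟩⟩
  loopless := ⟨fun _ ⟨_, h, _⟩ => h.ne rfl⟩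

/-- The discrete torus `ℤ_k^d`. -/
abbrev torus (d k : ℕ) : SimpleGraph (Fin d → Fin k) := boxPower (SimpleGraph.cycleGraph k) d

/-- The discrete grid `[k]^d`. -/
abbrev grid (d k : ℕ) : SimpleGraph (Fin d → Fin k) := boxPower (SimpleGraph.pathGraph k) d

end ChoiceWalk

/-! The upper bounds come from one greedy rule: towards a target `y`, accept the second offer
exactly when it is a neighbour `z` that shortens a largest coordinate distance `A`. At a vertex of
degree `D ≤ 2d` the step is then `z` with probability `1/D` and a uniform neighbour otherwise.

A uniform step does little harm: in a factor of degree at most two, at most one neighbour is farther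
from the target, so the changes of squared Euclidean distance over all neighbours sum to at most
`2d` (`sum_sqDist_sub_le`). The step to `z` changes it by `1 - 2A`. By concavity of the root, the
Euclidean distance `R` drifts by at most `(2d + 1 - 2A) / (2DR)`, which is at most `-1/(4d²)` once
`A ≥ 2d + 1`. Closer in, this may be positive, so the potential adds a bounded term `K(1 - ε^m)`,
with `m` the sum of coordinate distances, whose own drift is negative enough there
(`potential_drift`). Foster–Lyapunov (`tsum_lintegral_cost_le`) then gives hitting times `O(m + 1)`,
hence `O(k)`.

For covering, follow a closed walk of length at most `2n` through all vertices, taking its vertices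
as successive targets. Each leg joins adjacent vertices and costs `O(1)` in mean.

The lower bounds hold for every trajectory up to null sets: covering needs `n - 1` steps, and the
cyclic distance in one coordinate grows by at most one per step. -/

namespace ChoiceWalk

variable {V : Type*}

/-! ### Integration against the law of the walk -/

section Law

variable [Fintype V]

instance law.instIsProbabilityMeasure (G : SimpleGraph V) (σ : Strategy V) (v : V) :
    IsProbabilityMeasure (law G σ v) :=
  inferInstanceAs (IsProbabilityMeasure (Kernel.trajMeasure _ _))

/-- Integrals over the initial observation. -/
theorem lintegral_law_zero (G : SimpleGraph V) (σ : Strategy V) (v : V) (f : Obs V → ℝ≥0∞) :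
    ∫⁻ ω, f (ω 0) ∂law G σ v = ∫⁻ o, f o ∂(offerAt G v).toMeasure := by
  have hf : Measurable f := Measurable.of_discrete
  have key : (law G σ v).map (Preorder.frestrictLe 0) =
      (offerAt G v).toMeasure.map
        (MeasurableEquiv.piUnique (fun _ : Finset.Iic 0 => Obs V)).symm := by
    rw [law, Kernel.trajMeasure, Measure.map_comp _ _ (by fun_prop),
      Kernel.traj_map_frestrictLe, Kernel.partialTraj_self, Measure.id_comp]
  calc ∫⁻ ω, f (ω 0) ∂law G σ v
      = ∫⁻ h, f (h ⟨0, Finset.mem_Iic.2 le_rfl⟩) ∂(law G σ v).map (Preorder.frestrictLe 0) := by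
        rw [lintegral_map (by fun_prop) (by fun_prop)]; rfl
    _ = _ := by
        rw [key, lintegral_map (by fun_prop) (by fun_prop)]
        rfl

/-- Integrals over the next observation, conditionally on the history. -/
theorem lintegral_law_succ (G : SimpleGraph V) (σ : Strategy V) (v : V) (t : ℕ)
    (F : History V t → Obs V → ℝ≥0∞) :
    ∫⁻ ω, F (Preorder.frestrictLe t ω) (ω (t + 1)) ∂law G σ v =
      ∫⁻ ω, ∫⁻ o, F (Preorder.frestrictLe t ω) o
        ∂(nextObs G σ t (Preorder.frestrictLe t ω)).toMeasure ∂law G σ v := by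
  have hF : Measurable (Function.uncurry F) := Measurable.of_discrete
  have key := Kernel.map_frestrictLe_trajMeasure_compProd_eq_map_trajMeasure
    (X := fun _ => Obs V) (μ₀ := (offerAt G v).toMeasure) (κ := stepKernel G σ) (a := t)
  calc ∫⁻ ω, F (Preorder.frestrictLe t ω) (ω (t + 1)) ∂law G σ v
      = ∫⁻ p, Function.uncurry F p
          ∂(law G σ v).map (fun ω => (Preorder.frestrictLe t ω, ω (t + 1))) := by
        rw [lintegral_map hF (by fun_prop)]; rfl
    _ = ∫⁻ h, ∫⁻ o, F h o ∂(stepKernel G σ t h) ∂(law G σ v).map (Preorder.frestrictLe t) := by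
        rw [law, ← key, Measure.lintegral_compProd hF]; rfl
    _ = _ := by
        rw [lintegral_map (Measurable.of_discrete) (by fun_prop)]; rfl

end Law

/-- A trajectory extending a history. -/
def History.extend {t : ℕ} (h : History V t) : ℕ → Obs V :=
  -- Beyond time `t` the last observation is repeated; `state` at time `t` never reads those values.
  fun s => h ⟨min s t, Finset.mem_Iic.2 (min_le_right _ _)⟩

/-! ### Automaton-driven strategies and the Foster–Lyapunov bound -/

section Machine

variable {S : Type*} (step : S → V → S) (s₀ : S)

/-- The state, after time `t`, of an automaton reading the positions of the walk. -/
def state (ω : ℕ → Obs V) : ℕ → S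
  | 0 => step s₀ (ω 0).pos
  | t + 1 => step (state ω t) (ω (t + 1)).pos

theorem state_congr {ω ω' : ℕ → Obs V} {t : ℕ} (h : ∀ s ≤ t, ω s = ω' s) :
    state step s₀ ω t = state step s₀ ω' t := by
  induction t with
  | zero => simp [state, h 0 le_rfl]
  | succ t ih => simp [state, ih fun s hs => h s (hs.trans t.le_succ), h (t + 1) le_rfl]

theorem state_extend_frestrictLe (ω : ℕ → Obs V) (t : ℕ) :
    state step s₀ (History.extend (Preorder.frestrictLe t ω : History V t)) t =
      state step s₀ ω t :=
  state_congr step s₀ fun s hs => by simp [History.extend, hs]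

/-- The vertex chosen among the two offers by the rule `sel`. -/
def choose (sel : S → Obs V → Bool) (s : S) (o : Obs V) : V := cond (sel s o) o.c₁ o.c₂

/-- The deterministic strategy that applies the rule `sel` to the state of the automaton. -/
noncomputable def machineStrategy (sel : S → Obs V → Bool) : Strategy V :=
  fun t h => PMF.pure (sel (state step s₀ h.extend t) h.last)

theorem nextObs_machineStrategy [Fintype V] (G : SimpleGraph V) (sel : S → Obs V → Bool) (t : ℕ)
    (ω : ℕ → Obs V) :
    nextObs G (machineStrategy step s₀ sel) t (Preorder.frestrictLe t ω) =
      offerAt G (choose sel (state step s₀ ω t) (ω t)) := by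
  rw [nextObs, nextPos, machineStrategy, PMF.pure_map, PMF.pure_bind, state_extend_frestrictLe]
  rfl

/-- Foster–Lyapunov bound: if the potential `φ` drops in mean by the running cost, then the
expected total cost is at most the initial potential. -/
theorem tsum_lintegral_cost_le [Fintype V] (G : SimpleGraph V) (sel : S → Obs V → Bool) (x : V)
    (cost : S → ℝ≥0∞) (φ : S → V → ℝ≥0∞)
    (hpos : ∀ y, ∀ᵐ o ∂(offerAt G y).toMeasure, o.pos = y)
    (hφ : ∀ s y, cost (step s y) +
      ∫⁻ o, φ (step s y) (choose sel (step s y) o) ∂(offerAt G y).toMeasure ≤ φ s y) :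
    ∑' t, ∫⁻ ω, cost (state step s₀ ω t) ∂law G (machineStrategy step s₀ sel) x ≤ φ s₀ x := by
  set μ := law G (machineStrategy step s₀ sel) x
  have meas : ∀ (t : ℕ) (g : History V t → ℝ≥0∞),
      Measurable fun ω : ℕ → Obs V => g (Preorder.frestrictLe t ω) := fun t g =>
    (Measurable.of_discrete (f := g)).comp (by fun_prop)
  have mcost : ∀ t, Measurable fun ω : ℕ → Obs V => cost (state step s₀ ω t) := fun t => by
    simpa only [state_extend_frestrictLe] using
      meas t fun h => cost (state step s₀ h.extend t)
  have drift : ∀ s y, ∫⁻ o, cost (step s o.pos) + φ (step s o.pos) (choose sel (step s o.pos) o)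
      ∂(offerAt G y).toMeasure ≤ φ s y := fun s y => by
    refine le_trans (le_of_eq ?_) (hφ s y)
    rw [lintegral_congr_ae (g := fun o => cost (step s y) +
        φ (step s y) (choose sel (step s y) o)) ?_,
      lintegral_add_left measurable_const, lintegral_const, measure_univ, mul_one]
    filter_upwards [hpos y] with o ho
    simp only [ho]
  -- The state after time `t` is paired with the position already selected for time `t + 1`, which
  -- it has not yet read; this is the form in which `φ` enters the drift condition.
  let post : ℕ → (ℕ → Obs V) → ℝ≥0∞ := fun t ω =>
    φ (state step s₀ ω t) (choose sel (state step s₀ ω t) (ω t))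
  let b : ℕ → ℝ≥0∞ := fun t => ∫⁻ ω, post t ω ∂μ
  have h0 : ∫⁻ ω, cost (state step s₀ ω 0) ∂μ + b 0 ≤ φ s₀ x := by
    rw [← lintegral_add_left (mcost 0)]
    refine le_trans (le_of_eq ?_) (drift s₀ x)
    exact lintegral_law_zero G _ x fun o =>
      cost (step s₀ o.pos) + φ (step s₀ o.pos) (choose sel (step s₀ o.pos) o)
  have hs : ∀ t, ∫⁻ ω, cost (state step s₀ ω (t + 1)) ∂μ + b (t + 1) ≤ b t := fun t => by
    rw [← lintegral_add_left (mcost _)]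
    have := lintegral_law_succ G (machineStrategy step s₀ sel) x t fun h o =>
      cost (step (state step s₀ h.extend t) o.pos) + φ (step (state step s₀ h.extend t) o.pos)
        (choose sel (step (state step s₀ h.extend t) o.pos) o)
    simp only [state_extend_frestrictLe, nextObs_machineStrategy] at this
    refine (le_of_eq this).trans (lintegral_mono fun ω => drift _ _)
  have hsum : ∀ T, ∑ t ∈ Finset.range (T + 1), ∫⁻ ω, cost (state step s₀ ω t) ∂μ + b T ≤
      φ s₀ x := fun T => by
    induction T with
    | zero => simpa using h0
    | succ T ih =>
      rw [Finset.sum_range_succ, add_assoc]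
      exact (add_le_add_right (hs T) _).trans ih
  rw [ENNReal.tsum_eq_iSup_nat]
  refine iSup_le fun T => ?_
  refine (Finset.sum_le_sum_of_subset (Finset.range_subset_range.2 T.le_succ)).trans ?_
  exact le_self_add.trans (hsum T)

end Machine

/-! ### The law of an offer -/

theorem lintegral_toMeasure_eq_tsum {α : Type*} [MeasurableSpace α] [DiscreteMeasurableSpace α]
    [Countable α] (p : PMF α) (f : α → ℝ≥0∞) :
    ∫⁻ a, f a ∂p.toMeasure = ∑' a, p a * f a := by
  rw [lintegral_countable']
  refine tsum_congr fun a => ?_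
  rw [PMF.toMeasure_apply_singleton _ _ (MeasurableSet.singleton a), mul_comm]

theorem ae_toMeasure_iff {α : Type*} [MeasurableSpace α] [DiscreteMeasurableSpace α]
    (p : PMF α) (P : α → Prop) : (∀ᵐ a ∂p.toMeasure, P a) ↔ ∀ a ∈ p.support, P a := by
  rw [ae_iff, PMF.toMeasure_apply_eq_zero_iff _ (MeasurableSet.of_discrete), Set.disjoint_left]
  simp only [Set.mem_ofPred_eq, not_not]

section Law

variable {V : Type*} [Fintype V]

theorem mem_support_offerAt {G : SimpleGraph V} {v : V} {o : Obs V}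
    (ho : o ∈ (offerAt G v).support) : o.pos = v ∧ o.c₁ ∈ (randomNeighbour G v).support ∧
      o.c₂ ∈ (randomNeighbour G v).support := by
  simp only [offerAt, PMF.mem_support_bind_iff, PMF.mem_support_map_iff] at ho
  obtain ⟨a, ha, b, hb, rfl⟩ := ho
  exact ⟨rfl, ha, hb⟩

theorem eq_or_adj_of_mem_support_randomNeighbour {G : SimpleGraph V} {v w : V}
    (hw : w ∈ (randomNeighbour G v).support) : w = v ∨ G.Adj v w := by
  unfold randomNeighbour at hw
  split_ifs at hw with h
  · right; simpa using hw
  · left; simpa using hw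

theorem ae_offerAt_pos (G : SimpleGraph V) (v : V) :
    ∀ᵐ o ∂(offerAt G v).toMeasure, o.pos = v :=
  (ae_toMeasure_iff _ _).2 fun _ ho => (mem_support_offerAt ho).1

open Classical in
theorem lintegral_offerAt (G : SimpleGraph V) (v : V) (f : Obs V → ℝ≥0∞)
    (h : 0 < (Finset.univ.filter (G.Adj v)).card) :
    ∫⁻ o, f o ∂(offerAt G v).toMeasure =
      ((Finset.univ.filter (G.Adj v)).card : ℝ≥0∞)⁻¹ ^ 2 *
        ∑ a ∈ Finset.univ.filter (G.Adj v), ∑ b ∈ Finset.univ.filter (G.Adj v), f ⟨v, a, b⟩ := by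
  have hne : (Finset.univ.filter (G.Adj v)).Nonempty := Finset.card_pos.1 h
  have hsum : ∀ g : V → ℝ≥0∞, ∑' a, randomNeighbour G v a * g a =
      ((Finset.univ.filter (G.Adj v)).card : ℝ≥0∞)⁻¹ *
        ∑ a ∈ Finset.univ.filter (G.Adj v), g a := fun g => by
    rw [tsum_fintype, Finset.mul_sum, Finset.sum_filter]
    refine Finset.sum_congr rfl fun a _ => ?_
    rw [randomNeighbour, dif_pos hne, PMF.uniformOfFinset_apply]
    by_cases ha : G.Adj v a <;> simp [ha]
  have hbind : ∀ {α β : Type _} (p : PMF α) (q : α → PMF β) (f : β → ℝ≥0∞),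
      ∑' b, (p.bind q) b * f b = ∑' a, p a * ∑' b, q a b * f b := fun p q f => by
    simp_rw [PMF.bind_apply, ← ENNReal.tsum_mul_right, ← ENNReal.tsum_mul_left, mul_assoc]
    exact ENNReal.tsum_comm
  have hpure : ∀ (b : Obs V) (f : Obs V → ℝ≥0∞), ∑' c, PMF.pure b c * f c = f b :=
    fun b f => by
      rw [tsum_eq_single b (fun c hc => by rw [PMF.pure_apply, if_neg hc, zero_mul])]
      rw [PMF.pure_apply, if_pos rfl, one_mul]
  rw [lintegral_toMeasure_eq_tsum, offerAt, hbind]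
  simp only [← PMF.bind_pure_comp, hbind, Function.comp_apply, hpure, hsum]
  rw [pow_two, mul_assoc, ← Finset.mul_sum]

end Law

/-! ### Following a list of targets -/

section Tour

variable {V : Type*}

open Classical in
/-- Remove from a list of targets those that the walk has just reached. -/
noncomputable def nextTargets (l : List V) (x : V) : List V := l.dropWhile fun y => y = x

open Classical in
/-- Accept the second offer only if it is the neighbour `r x y` that the walk at `x` prefers when
its target is `y`. -/
noncomputable def selectTowards (r : V → V → V) : List V → Obs V → Bool
  | [], _ => true
  | y :: _, o => decide (o.c₂ ≠ r o.pos y)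

/-- The potential of a list of targets: the sum of the potentials of its legs. -/
def tourPotential (φ : V → V → ℝ≥0∞) : List V → V → ℝ≥0∞
  | [], _ => 0
  | y :: l, x => φ x y + tourPotential φ l y

/-- Every target removed equals `x`, and its leg starts at `x`, so it contributes `φ x x = 0`. Hence
drift is needed only towards a target different from the current position. -/
theorem tourPotential_nextTargets {φ : V → V → ℝ≥0∞} (h0 : ∀ x, φ x x = 0) (l : List V) (x : V) :
    tourPotential φ (nextTargets l x) x = tourPotential φ l x := by
  induction l with
  | nil => rfl
  | cons y l ih =>
    by_cases hy : y = x
    · subst hy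
      simpa [nextTargets, tourPotential, h0] using ih
    · simp [nextTargets, hy]

theorem tourPotential_support_tail_le {G : SimpleGraph V} {φ : V → V → ℝ≥0∞} {M : ℝ≥0∞}
    (hM : ∀ x y, G.Adj x y → φ x y ≤ M) {x y : V} (p : G.Walk x y) : tourPotential φ p.support.tail x ≤ p.length * M := by
  induction p with
  | nil => simp [tourPotential]
  | @cons u v w hadj p ih =>
    rw [SimpleGraph.Walk.support_cons, List.tail_cons, ← p.cons_tail_support, tourPotential,
      SimpleGraph.Walk.length_cons, Nat.cast_succ, add_mul, one_mul, add_comm]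
    exact add_le_add ih (hM _ _ hadj)

theorem head_nextTargets_ne {l l' : List V} {x y : V} (h : nextTargets l x = y :: l') :
    y ≠ x := by
  classical
  have := List.head_dropWhile_not (p := fun z => decide (z = x)) (l := l)
    (by rw [nextTargets] at h; rw [h]; simp)
  unfold nextTargets at h
  simpa [h] using this

/-- The automaton deletes only copies of the current position, so a target can leave the list only
by being visited. -/
theorem mem_of_state_eq_nil {L : List V} {ω : ℕ → Obs V} {t : ℕ}
    {y : V} (hy : y ∈ L) (h : y ∉ state nextTargets L ω t) : ∃ s ≤ t, (ω s).pos = y := by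
  classical
  have drop : ∀ (l : List V) (x : V), y ∈ l → y ∉ nextTargets l x → y = x := by
    intro l x hl hn
    rw [nextTargets] at hn
    rw [← List.takeWhile_append_dropWhile (p := fun z => decide (z = x)) (l := l),
      List.mem_append] at hl
    simpa using List.mem_takeWhile_imp (hl.resolve_right hn)
  induction t with
  | zero => exact ⟨0, le_rfl, (drop _ _ hy h).symm⟩
  | succ t ih =>
    by_cases hm : y ∈ state nextTargets L ω t
    · exact ⟨t + 1, le_rfl, (drop _ _ hm h).symm⟩
    · obtain ⟨s, hs, h⟩ := ih hm
      exact ⟨s, hs.trans t.le_succ, h⟩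

open Classical in
/-- Cost one for each time step at which targets remain. -/
noncomputable def pendingCost (l : List V) : ℝ≥0∞ := if l = [] then 0 else 1

theorem iInf_le_tsum_pendingCost (S : ℕ → List V) :
    ⨅ (t : ℕ) (_ : S t = []), (t : ℝ≥0∞) ≤ ∑' t, pendingCost (S t) := by
  classical
  by_cases h : ∃ t, S t = []
  · refine (iInf₂_le (Nat.find h) (Nat.find_spec h)).trans ?_
    refine le_trans (le_of_eq ?_) (ENNReal.sum_le_tsum (Finset.range (Nat.find h)))
    rw [Finset.sum_congr rfl (g := fun _ => (1 : ℝ≥0∞)) fun t ht => ?_]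
    · simp
    · simp [pendingCost, Nat.find_min h (Finset.mem_range.1 ht)]
  · push Not at h
    simp [pendingCost, h]

variable [Fintype V] (G : SimpleGraph V) (r : V → V → V) (φ : V → V → ℝ≥0∞)

/-- The mean drift condition: with target `y`, one step from `x ≠ y` lowers the potential by one in
mean. -/
def HasDrift : Prop :=
  (∀ x, φ x x = 0) ∧ ∀ x y, x ≠ y →
    1 + ∫⁻ o, φ (choose (selectTowards r) [y] o) y ∂(offerAt G x).toMeasure ≤ φ x y

variable {G r φ}

/-- Until the head target is reached, the later legs of the tour potential stay constant, so the
drift of the first leg pays for each step. -/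
theorem HasDrift.lintegral_tour_le (h : HasDrift G r φ) (L : List V) (x : V) :
    ∫⁻ ω, ⨅ (t : ℕ) (_ : state nextTargets L ω t = []), (t : ℝ≥0∞)
      ∂law G (machineStrategy nextTargets L (selectTowards r)) x ≤ tourPotential φ L x := by
  refine (lintegral_mono fun ω => iInf_le_tsum_pendingCost _).trans ?_
  rw [lintegral_tsum fun t => ?_]
  · refine tsum_lintegral_cost_le nextTargets L G (selectTowards r) x pendingCost
      (tourPotential φ) (ae_offerAt_pos G) fun s y => ?_
    rw [← tourPotential_nextTargets h.1 s y]
    cases hl : nextTargets s y with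
    | nil => simp [pendingCost, tourPotential]
    | cons z l =>
      have hz := head_nextTargets_ne hl
      simp only [pendingCost, tourPotential, reduceCtorEq, if_false]
      rw [lintegral_add_right _ measurable_const, lintegral_const, measure_univ, mul_one,
        ← add_assoc]
      -- `selectTowards` inspects only the head of the list, so the drift stated for `[z]` applies
      -- to `z :: l`.
      exact add_le_add_left (h.2 y z hz.symm) _
  · have : Measurable fun g : History V t => pendingCost (state nextTargets L g.extend t) :=
      Measurable.of_discrete
    simpa only [Function.comp_def, state_extend_frestrictLe] using
      (this.comp (g := fun g : History V t => pendingCost (state nextTargets L g.extend t))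
        (f := Preorder.frestrictLe (π := fun _ => Obs V) t) (by fun_prop)).aemeasurable

theorem HasDrift.hittingTimeFrom_le (h : HasDrift G r φ) (x y : V) :
    hittingTimeFrom G x y ≤ φ x y := by
  refine (iInf_le _ (machineStrategy nextTargets [y] (selectTowards r))).trans ?_
  refine le_trans (lintegral_mono fun ω => ?_)
    ((h.lintegral_tour_le [y] x).trans (by simp [tourPotential]))
  refine le_iInf₂ fun t ht => ?_
  obtain ⟨s, hs, hy⟩ := mem_of_state_eq_nil (L := [y]) (y := y) (by simp)
    (by rw [ht]; simp)
  exact (iInf₂_le s hy).trans (by exact_mod_cast hs)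

theorem HasDrift.coverTimeFrom_le (h : HasDrift G r φ) (L : List V) (hL : ∀ y, y ∈ L) (x : V) :
    coverTimeFrom G x ≤ tourPotential φ L x := by
  refine (iInf_le _ (machineStrategy nextTargets L (selectTowards r))).trans ?_
  refine le_trans (lintegral_mono fun ω => ?_) (h.lintegral_tour_le L x)
  refine le_iInf₂ fun t ht => iInf₂_le t fun y => ?_
  exact mem_of_state_eq_nil (hL y) (by rw [ht]; simp)

end Tour

/-! ### Cover time from a closed covering walk -/

section Cover

variable {V : Type*} [Fintype V]

/-- A connected graph has a closed walk through all vertices that crosses at most `2 (n - 1)`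
edges. -/
theorem exists_covering_walk {G : SimpleGraph V} (hG : G.Connected) (x : V) :
    ∃ p : G.Walk x x, p.length ≤ 2 * Fintype.card V ∧ ∀ y, y ∈ p.support := by
  classical
  -- Grow the walk by detours: while a vertex is missing, some edge leaves the visited set, and
  -- crossing it back and forth costs two steps and adds a vertex.
  have key : ∀ m : ℕ, ∃ p : G.Walk x x, p.length ≤ 2 * m ∧
      ((∀ y, y ∈ p.support) ∨ m + 1 ≤ p.support.toFinset.card) := by
    intro m
    induction m with
    | zero => exact ⟨.nil, by simp, by simp⟩
    | succ m ih =>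
      obtain ⟨p, hp, hc⟩ := ih
      by_cases hall : ∀ y, y ∈ p.support
      · exact ⟨p, by omega, .inl hall⟩
      · have hcard := hc.resolve_left hall
        push Not at hall
        obtain ⟨z, hz⟩ := hall
        obtain ⟨q⟩ := hG.preconnected x z
        obtain ⟨e, he, h1, h2⟩ := q.exists_boundary_dart {v | v ∈ p.support}
          p.start_mem_support hz
        have h1' : e.fst ∈ p.support := h1
        have h2' : e.snd ∉ p.support := h2
        refine ⟨(p.takeUntil _ h1').append (.cons e.adj (.cons e.adj.symm (p.dropUntil _ h1'))),
          ?_, .inr ?_⟩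
        · have := congrArg SimpleGraph.Walk.length (p.take_spec h1')
          simp only [SimpleGraph.Walk.length_append, SimpleGraph.Walk.length_cons] at this ⊢
          omega
        · have hsub : insert e.snd p.support.toFinset ⊆ ((p.takeUntil _ h1').append
              (.cons e.adj (.cons e.adj.symm (p.dropUntil _ h1')))).support.toFinset := by
            intro v hv
            simp only [Finset.mem_insert, List.mem_toFinset] at hv
            simp only [List.mem_toFinset, SimpleGraph.Walk.mem_support_append_iff,
              SimpleGraph.Walk.support_cons, List.mem_cons]
            rcases hv with rfl | hv
            · simp
            · rw [← p.take_spec h1', SimpleGraph.Walk.mem_support_append_iff] at hv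
              tauto
          have := Finset.card_le_card hsub
          rw [Finset.card_insert_of_notMem (by simpa using h2')] at this
          omega
  obtain ⟨p, hp, hc⟩ := key (Fintype.card V)
  refine ⟨p, hp, hc.resolve_right fun h => ?_⟩
  have := p.support.toFinset.card_le_univ
  omega

/-- A drift towards every target, with potential at most `M` between adjacent vertices, gives a
linear cover time. -/
theorem HasDrift.coverTime_le {G : SimpleGraph V} {r : V → V → V} {φ : V → V → ℝ≥0∞}
    (h : HasDrift G r φ) (hG : G.Connected) {M : ℝ≥0∞} (hM : ∀ x y, G.Adj x y → φ x y ≤ M) :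
    coverTime G ≤ 2 * Fintype.card V * M := by
  refine iSup_le fun x => ?_
  obtain ⟨p, hp, hc⟩ := exists_covering_walk hG x
  refine (h.coverTimeFrom_le p.support hc x).trans ?_
  rw [← p.cons_tail_support, tourPotential, h.1, zero_add]
  refine (tourPotential_support_tail_le hM p).trans ?_
  gcongr
  exact_mod_cast hp

end Cover

/-! ### Distances in a factor of degree at most two -/

theorem exists_adj_dist_add_one {α : Type*} {H : SimpleGraph α} (hH : H.Connected) {u v : α}
    (h : u ≠ v) : ∃ w, H.Adj u w ∧ H.dist w v + 1 = H.dist u v := by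
  obtain ⟨p, hp⟩ := hH.exists_walk_length_eq_dist u v
  cases p with
  | nil => exact absurd rfl h
  | @cons _ w _ hadj p =>
    refine ⟨w, hadj, le_antisymm ?_ ?_⟩
    · rw [← hp, SimpleGraph.Walk.length_cons]
      exact Nat.succ_le_succ (SimpleGraph.dist_le p)
    · have := hH.dist_triangle (u := u) (v := w) (w := v)
      rw [SimpleGraph.dist_eq_one_iff_adj.2 hadj] at this
      omega

-- If `u ≠ v` are at distance `δ`, one neighbour is closer and contributes `1 - 2δ`, while the at
-- most one other contributes at most `1 + 2δ`. If `u = v`, each of at most two neighbours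
-- contributes at most one.
open Classical in
theorem sum_sq_dist_sub_le {α : Type*} [Fintype α] {H : SimpleGraph α} (hH : H.Connected)
    (hdeg : ∀ u, (Finset.univ.filter (H.Adj u)).card ≤ 2) (u v : α) :
    ∑ w ∈ Finset.univ.filter (H.Adj u), ((H.dist w v : ℝ) ^ 2 - (H.dist u v : ℝ) ^ 2) ≤ 2 := by
  have hstep : ∀ w, H.Adj u w → (H.dist w v : ℝ) ≤ H.dist u v + 1 := fun w hw => by
    have := hH.dist_triangle (u := w) (v := u) (w := v)
    rw [SimpleGraph.dist_eq_one_iff_adj.2 hw.symm] at this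
    exact_mod_cast this.trans (add_comm _ _).le
  have hterm : ∀ w ∈ Finset.univ.filter (H.Adj u),
      (H.dist w v : ℝ) ^ 2 - (H.dist u v : ℝ) ^ 2 ≤ 2 * H.dist u v + 1 := fun w hw => by
    have := hstep w (by simpa using hw)
    have h0 : (0 : ℝ) ≤ H.dist w v := by positivity
    nlinarith
  by_cases h : u = v
  · refine (Finset.sum_le_card_nsmul _ _ _ hterm).trans ?_
    have : ((Finset.univ.filter (H.Adj u)).card : ℝ) ≤ 2 := by exact_mod_cast hdeg u
    simpa [h] using this
  · obtain ⟨r, hr, hd⟩ := exists_adj_dist_add_one hH h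
    have hr' : r ∈ Finset.univ.filter (H.Adj u) := by simpa using hr
    have hd' : (H.dist u v : ℝ) = H.dist r v + 1 := by exact_mod_cast hd.symm
    rw [← Finset.add_sum_erase _ _ hr']
    have h1 := Finset.sum_le_card_nsmul ((Finset.univ.filter (H.Adj u)).erase r) _ _
      fun w hw => hterm w (Finset.mem_of_mem_erase hw)
    have h2 : (((Finset.univ.filter (H.Adj u)).erase r).card : ℝ) ≤ 1 := by
      rw [Finset.card_erase_of_mem hr']
      exact_mod_cast Nat.sub_le_of_le_add (hdeg u)
    have h0 : (0 : ℝ) ≤ H.dist r v := by positivity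
    rw [nsmul_eq_mul] at h1
    rw [hd'] at h1 ⊢
    nlinarith

/-! ### Distances in box powers -/

section Box

variable {α : Type*} {H : SimpleGraph α} {d : ℕ}

open Classical in
theorem sum_boxPower_adj [Fintype α] {M : Type*} [AddCommMonoid M] (H : SimpleGraph α)
    (x : Fin d → α) (F : (Fin d → α) → M) :
    ∑ z ∈ Finset.univ.filter ((boxPower H d).Adj x), F z =
      ∑ i, ∑ w ∈ Finset.univ.filter (H.Adj (x i)), F (Function.update x i w) := by
  rw [Finset.sum_sigma']
  symm
  refine Finset.sum_nbij (fun p => Function.update x p.1 p.2) ?_ ?_ ?_ fun _ _ => rfl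
  · rintro ⟨i, w⟩ h
    simp only [Finset.mem_sigma, Finset.mem_univ, true_and, Finset.mem_filter] at h ⊢
    exact ⟨i, by simpa using h, fun j hj => by simp [hj]⟩
  · rintro ⟨i, w⟩ h ⟨j, w'⟩ - heq
    have hw : H.Adj (x i) w := by simpa using h
    simp only at heq
    have h1 := congrFun heq i
    by_cases hij : i = j
    · subst hij
      simpa using h1
    · rw [Function.update_self, Function.update_of_ne hij] at h1
      exact absurd h1.symm hw.ne
  · rintro z hz
    obtain ⟨i, hi, h⟩ : (boxPower H d).Adj x z := by simpa using hz
    refine ⟨⟨i, z i⟩, by simpa using hi, ?_⟩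
    ext j
    by_cases hj : j = i
    · subst hj; simp
    · simp [hj, h j hj]

/-- The squared Euclidean length of the vector of coordinate distances. -/
noncomputable def sqDist (H : SimpleGraph α) (x y : Fin d → α) : ℝ :=
  ∑ i, (H.dist (x i) (y i) : ℝ) ^ 2

/-- The sum of the coordinate distances. -/
noncomputable def sumDist (H : SimpleGraph α) (x y : Fin d → α) : ℕ := ∑ i, H.dist (x i) (y i)

theorem sqDist_update [DecidableEq (Fin d)] (x y : Fin d → α) (i : Fin d) (w : α) :
    sqDist H (Function.update x i w) y =
      sqDist H x y + ((H.dist w (y i) : ℝ) ^ 2 - (H.dist (x i) (y i) : ℝ) ^ 2) := by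
  unfold sqDist
  rw [← Finset.add_sum_erase _ _ (Finset.mem_univ i),
    ← Finset.add_sum_erase (a := i) _ (fun j => (H.dist (x j) (y j) : ℝ) ^ 2) (Finset.mem_univ i),
    Finset.sum_congr rfl fun j hj => by rw [Function.update_of_ne (Finset.ne_of_mem_erase hj)]]
  simp only [Function.update_self]
  ring

theorem sumDist_update_add [DecidableEq (Fin d)] (x y : Fin d → α) (i : Fin d) (w : α) :
    sumDist H (Function.update x i w) y + H.dist (x i) (y i) =
      sumDist H x y + H.dist w (y i) := by
  unfold sumDist
  rw [← Finset.add_sum_erase _ _ (Finset.mem_univ i),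
    ← Finset.add_sum_erase (a := i) _ (fun j => H.dist (x j) (y j)) (Finset.mem_univ i),
    Finset.sum_congr rfl fun j hj => by rw [Function.update_of_ne (Finset.ne_of_mem_erase hj)]]
  simp only [Function.update_self]
  ring

theorem sqDist_le_sumDist_sq (x y : Fin d → α) : sqDist H x y ≤ (sumDist H x y : ℝ) ^ 2 := by
  rw [sumDist, Nat.cast_sum]
  exact Finset.sum_sq_le_sq_sum_of_nonneg fun _ _ => by positivity

open Classical in
theorem sum_sqDist_sub_le [Fintype α] (hH : H.Connected)
    (hdeg : ∀ u, (Finset.univ.filter (H.Adj u)).card ≤ 2)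
    (x y : Fin d → α) :
    ∑ z ∈ Finset.univ.filter ((boxPower H d).Adj x), (sqDist H z y - sqDist H x y) ≤ 2 * d := by
  rw [sum_boxPower_adj]
  simp only [sqDist_update, add_sub_cancel_left]
  refine (Finset.sum_le_card_nsmul Finset.univ _ 2 fun i _ =>
    sum_sq_dist_sub_le hH hdeg (x i) (y i)).trans (le_of_eq ?_)
  simp [mul_comm]

open Classical in
theorem card_boxPower_adj_le [Fintype α]
    (hdeg : ∀ u, (Finset.univ.filter (H.Adj u)).card ≤ 2)
    (x : Fin d → α) : (Finset.univ.filter ((boxPower H d).Adj x)).card ≤ 2 * d := by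
  rw [Finset.card_eq_sum_ones, sum_boxPower_adj]
  simp only [Finset.sum_const, smul_eq_mul, mul_one]
  refine (Finset.sum_le_card_nsmul Finset.univ _ 2 fun i _ => hdeg (x i)).trans (le_of_eq ?_)
  simp [mul_comm]

/-- Away from the target there is a neighbour that decreases the largest coordinate distance. -/
theorem exists_preferred (hH : H.Connected) {x y : Fin d → α} (h : x ≠ y) :
    ∃ (z : Fin d → α) (A : ℕ), (boxPower H d).Adj x z ∧ 1 ≤ A ∧
      (∀ i, H.dist (x i) (y i) ≤ A) ∧ sqDist H z y = sqDist H x y + (1 - 2 * A) ∧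
      sumDist H z y + 1 = sumDist H x y := by
  classical
  obtain ⟨i₀, hi₀⟩ := Function.ne_iff.1 h
  obtain ⟨i, -, hi⟩ := Finset.exists_max_image Finset.univ (fun i => H.dist (x i) (y i))
    ⟨i₀, Finset.mem_univ _⟩
  have hpos : 1 ≤ H.dist (x i) (y i) :=
    (hH.pos_dist_of_ne hi₀).trans_le (hi i₀ (Finset.mem_univ _))
  have hne : x i ≠ y i := fun he => by simp [he] at hpos
  obtain ⟨w, hw, hd⟩ := exists_adj_dist_add_one hH hne
  refine ⟨Function.update x i w, H.dist (x i) (y i),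
    ⟨i, by simpa using hw, fun j hj => by simp [hj]⟩, hpos, fun j => hi j (Finset.mem_univ _),
    ?_, ?_⟩
  · rw [sqDist_update, ← hd]
    push_cast
    ring
  · have := sumDist_update_add (H := H) x y i w
    omega

theorem sumDist_self (x : Fin d → α) : sumDist H x x = 0 := by simp [sumDist]

theorem sqDist_self (x : Fin d → α) : sqDist H x x = 0 := by simp [sqDist]

theorem sumDist_of_adj {x y : Fin d → α} (h : (boxPower H d).Adj x y) : sumDist H x y = 1 := by
  obtain ⟨i, hi, hj⟩ := h
  rw [sumDist, Finset.sum_eq_single i (fun j _ hji => by rw [hj j hji, SimpleGraph.dist_self])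
    (by simp), SimpleGraph.dist_eq_one_iff_adj.2 hi]

theorem boxPower_connected (hH : H.Connected) (d : ℕ) : (boxPower H d).Connected := by
  have := hH.nonempty
  refine ⟨fun x y => ?_⟩
  induction hm : sumDist H x y generalizing x with
  | zero =>
    by_cases h : x = y
    · rw [h]
    · obtain ⟨z, A, -, -, -, -, hs⟩ := exists_preferred hH h
      omega
  | succ m ih =>
    by_cases h : x = y
    · rw [h]
    · obtain ⟨z, A, hz, -, -, -, hs⟩ := exists_preferred hH h
      exact hz.reachable.trans (ih z (by omega))

end Box

/-! ### The potential and its drift -/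

section Drift

/-- Divided by the square of `N.card`, this says that the greedy step has law `1/D` at `z` plus `1 -
1/D` times uniform, with `D = N.card`. -/
theorem sum_sum_prefer {V : Type*} [DecidableEq V] (N : Finset V) {z : V} (hz : z ∈ N) (g : V → ℝ) :
    ∑ a ∈ N, ∑ b ∈ N, g (if b = z then b else a) =
      N.card * g z + (N.card - 1) * ∑ a ∈ N, g a := by
  have : ∀ a, ∑ b ∈ N, g (if b = z then b else a) = g z + (N.card - 1) * g a := fun a => by
    rw [← Finset.add_sum_erase _ _ hz, if_pos rfl,
      Finset.sum_congr rfl (g := fun _ => g a) fun b hb => by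
        rw [if_neg (Finset.ne_of_mem_erase hb)],
      Finset.sum_const, Finset.card_erase_of_mem hz, nsmul_eq_mul,
      Nat.cast_pred (Finset.card_pos.2 ⟨z, hz⟩)]
  simp_rw [this, Finset.sum_add_distrib, Finset.sum_const, nsmul_eq_mul, ← Finset.mul_sum]

/-- Concavity turns bounds on the change of squared distance into bounds on the change of distance.
-/
theorem sqrt_le_tangent {s u : ℝ} (hs : 0 < s) (hu : 0 ≤ u) :
    √u ≤ √s + (u - s) / (2 * √s) := by
  have h1 := Real.sqrt_pos.2 hs
  have h2 := Real.sq_sqrt hs.le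
  have h3 := Real.sq_sqrt hu
  rw [← sub_le_iff_le_add', le_div_iff₀ (by positivity)]
  nlinarith [sq_nonneg (√u - √s)]

/-- The ratio of the geometric correction in the potential. -/
noncomputable def potentialRatio (d : ℕ) : ℝ := 1 / (4 * d)

/-- The weight of the geometric correction in the potential. -/
noncomputable def potentialWeight (d : ℕ) : ℝ :=
  -- The numerator bounds the outward Euclidean drift, plus one to spare; the exponent bounds `m`
  -- wherever the largest coordinate distance is at most `2d + 1`.
  ((2 * d + 1) / 2 + 1) / potentialRatio d ^ (d * (2 * d + 1))

/-- The potential as a function of the squared length and the sum of the coordinate distances. -/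
noncomputable def potential (d : ℕ) (s : ℝ) (m : ℕ) : ℝ :=
  √s + potentialWeight d * (1 - potentialRatio d ^ m)

variable {d : ℕ} (hd : 1 ≤ d)
include hd

theorem potentialRatio_pos : 0 < potentialRatio d := by
  have : (0 : ℝ) < d := by exact_mod_cast hd
  unfold potentialRatio
  positivity

theorem potentialRatio_le_one : potentialRatio d ≤ 1 := by
  have : (1 : ℝ) ≤ d := by exact_mod_cast hd
  rw [potentialRatio, div_le_one (by positivity)]
  linarith

theorem potentialWeight_pos : 0 < potentialWeight d := by
  have := potentialRatio_pos hd
  unfold potentialWeight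
  positivity

theorem potential_nonneg (s : ℝ) (m : ℕ) : 0 ≤ potential d s m := by
  have h1 := pow_le_one₀ (n := m) (potentialRatio_pos hd).le (potentialRatio_le_one hd)
  have := mul_nonneg (potentialWeight_pos hd).le (sub_nonneg.2 h1)
  unfold potential
  positivity

theorem potential_le {s : ℝ} {m : ℕ} (h : s ≤ (m : ℝ) ^ 2) :
    potential d s m ≤ m + potentialWeight d := by
  have h1 : √s ≤ m := Real.sqrt_le_iff.2 ⟨by positivity, h⟩
  have h2 := pow_pos (potentialRatio_pos hd) m
  have := mul_pos (potentialWeight_pos hd) h2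
  unfold potential
  linarith

/-- The mean drift of the potential under a step that goes to the preferred neighbour `z` with
probability `1 - (1 - 1 / D) ^ 2`. -/
theorem potential_drift {V : Type*} [DecidableEq V] (N : Finset V) {z : V} (hz : z ∈ N)
    (hN : N.card ≤ 2 * d) (s : V → ℝ) (m : V → ℕ) (s₀ : ℝ) (m₀ A : ℕ) (hs : ∀ a, 0 ≤ s a)
    (hs₀ : 1 ≤ s₀) (hm₀ : m₀ ≤ d * A) (hsm : s₀ ≤ (m₀ : ℝ) ^ 2) (hA : 1 ≤ A)
    (hsum : ∑ a ∈ N, (s a - s₀) ≤ 2 * d) (hsz : s z = s₀ + (1 - 2 * A)) (hmz : m z + 1 = m₀) :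
    ((N.card : ℝ)⁻¹) ^ 2 *
      ∑ a ∈ N, ∑ b ∈ N, potential d (s (if b = z then b else a)) (m (if b = z then b else a)) ≤
      potential d s₀ m₀ - 1 / (4 * d ^ 2) := by
  have hd' : (1 : ℝ) ≤ d := by exact_mod_cast hd
  have hD1 : (1 : ℝ) ≤ N.card := by exact_mod_cast Finset.card_pos.2 ⟨z, hz⟩
  have hD2 : (N.card : ℝ) ≤ 2 * d := by exact_mod_cast hN
  have hA' : (1 : ℝ) ≤ A := by exact_mod_cast hA
  have hε := potentialRatio_pos hd
  have hε1 := potentialRatio_le_one hd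
  have hK := potentialWeight_pos hd
  have hroot1 : 1 ≤ √s₀ := Real.one_le_sqrt.2 hs₀
  have hrootm : √s₀ ≤ d * A :=
    (Real.sqrt_le_iff.2 ⟨by positivity, hsm⟩).trans (by exact_mod_cast hm₀)
  rw [sum_sum_prefer N hz fun a => potential d (s a) (m a)]
  set D := (N.card : ℝ)
  set ε := potentialRatio d
  set K := potentialWeight d
  set R := √s₀
  -- bounds for one neighbour
  have hone : ∀ a, potential d (s a) (m a) ≤ R + (s a - s₀) / (2 * R) + K := fun a => by
    have h1 := sqrt_le_tangent (lt_of_lt_of_le one_pos hs₀) (hs a)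
    have h2 := mul_pos hK (pow_pos hε (m a))
    unfold potential
    linarith
  have hzb : potential d (s z) (m z) ≤ R + (1 - 2 * A) / (2 * R) + K - K * ε ^ m z := by
    have h1 := sqrt_le_tangent (lt_of_lt_of_le one_pos hs₀) (hs z)
    rw [hsz, add_sub_cancel_left, ← hsz] at h1
    unfold potential
    linarith
  have hsumb : ∑ a ∈ N, potential d (s a) (m a) ≤ D * (R + K) + 2 * d / (2 * R) := by
    refine (Finset.sum_le_sum fun a _ => hone a).trans ?_
    simp_rw [add_right_comm R _ K]
    rw [Finset.sum_add_distrib, Finset.sum_const, nsmul_eq_mul, ← Finset.sum_div]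
    gcongr
  have hε4 : ε * (4 * d) = 1 := by
    simp only [ε, potentialRatio]
    field_simp
  have hpow : ε ^ m z = 4 * d * ε ^ m₀ := by
    rw [← hmz, pow_succ]
    linear_combination (-ε ^ m z) * hε4
  have hPpos : 0 < ε ^ m₀ := pow_pos hε _
  -- the main estimate
  have hmain : D⁻¹ ^ 2 * (D * potential d (s z) (m z) + (D - 1) * ∑ a ∈ N, potential d (s a) (m a))
      ≤ R + K + (2 * d + 1 - 2 * A) / (2 * D * R) - 2 * K * ε ^ m₀ := by
    have h1 : D * potential d (s z) (m z) + (D - 1) * ∑ a ∈ N, potential d (s a) (m a) ≤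
        D * (R + (1 - 2 * A) / (2 * R) + K - K * ε ^ m z) +
          (D - 1) * (D * (R + K) + 2 * d / (2 * R)) := by
      have : 0 ≤ D - 1 := by linarith
      gcongr
    have h2 : (D - 1) * (2 * d / (2 * R)) ≤ D * (2 * d / (2 * R)) := by
      gcongr
      linarith
    -- The ratio `1/(4d)` is chosen so that `ε ^ m z = 4d ε ^ m₀ ≥ 2D ε ^ m₀`: even at weight `1/D`,
    -- the step to `z` yields two copies of `K ε ^ m₀`.
    have h3 : D * (K * (2 * D * ε ^ m₀)) ≤ D * (K * ε ^ m z) := by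
      have : 2 * D ≤ 4 * d := by linarith
      rw [hpow]
      exact mul_le_mul_of_nonneg_left (mul_le_mul_of_nonneg_left
        (mul_le_mul_of_nonneg_right this hPpos.le) hK.le) (by linarith)
    have h4 : D * potential d (s z) (m z) + (D - 1) * ∑ a ∈ N, potential d (s a) (m a) ≤
        D ^ 2 * (R + K + (2 * d + 1 - 2 * A) / (2 * D * R) - 2 * K * ε ^ m₀) := by
      refine h1.trans ?_
      have e : D ^ 2 * ((2 * d + 1 - 2 * A) / (2 * D * R)) =
          D * ((1 - 2 * A) / (2 * R)) + D * (2 * d / (2 * R)) := by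
        field_simp
        ring
      linear_combination h2 + h3 - e
    rw [inv_pow, inv_mul_le_iff₀ (by positivity)]
    exact h4
  refine hmain.trans ?_
  -- One of the two copies of `K ε ^ m₀` is already contained in `potential d s₀ m₀`; the other is
  -- left to absorb outward drift.
  have hfin : (2 * d + 1 - 2 * A) / (2 * D * R) - K * ε ^ m₀ ≤ -(1 / (4 * (d : ℝ) ^ 2)) := by
    -- Far from the target the Euclidean term suffices, since `D ≤ 2d` and `R ≤ dA`. Otherwise `m₀ ≤
    -- d(2d + 1)` and the choice of `K` makes the correction dominate.
    by_cases hbig : 2 * d + 1 ≤ A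
    · have hbig' : (2 * d + 1 : ℝ) ≤ A := by exact_mod_cast hbig
      have h1 : (2 * d + 1 - 2 * A) / (2 * D * R) ≤ -(A : ℝ) / (2 * D * R) := by
        gcongr
        linarith
      have h2 : 1 / (4 * (d : ℝ) ^ 2) ≤ A / (2 * D * R) := by
        rw [div_le_div_iff₀ (by positivity) (by positivity)]
        have : D * R ≤ 2 * d * (d * A) := by gcongr
        linarith
      have h3 := mul_pos hK hPpos
      rw [neg_div] at h1
      linarith
    · have h1 : (2 * d + 1 - 2 * A) / (2 * D * R) ≤ (2 * d + 1 : ℝ) / 2 := by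
        have hDR : 1 ≤ D * R := one_le_mul_of_one_le_of_one_le hD1 hroot1
        rw [div_le_div_iff₀ (by positivity) two_pos]
        nlinarith
      have h2 : K * ε ^ (d * (2 * d + 1)) = (2 * d + 1) / 2 + 1 :=
        div_mul_cancel₀ _ (pow_pos hε _).ne'
      have h3 : K * ε ^ (d * (2 * d + 1)) ≤ K * ε ^ m₀ := by
        refine mul_le_mul_of_nonneg_left (pow_le_pow_of_le_one hε.le hε1 ?_) hK.le
        exact hm₀.trans (Nat.mul_le_mul_left _ (by omega))
      have h4 : 1 / (4 * (d : ℝ) ^ 2) ≤ 1 := by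
        rw [div_le_one (by positivity)]
        nlinarith
      linarith
  unfold potential
  linarith

end Drift

/-! ### The greedy rule on box powers -/

section BoxDrift

variable {α : Type*} {H : SimpleGraph α} {d : ℕ}

/-- The potential of a position with respect to a target, scaled to have unit drift. -/
noncomputable def boxPotential (H : SimpleGraph α) (x y : Fin d → α) : ℝ≥0∞ :=
  ENNReal.ofReal (4 * d ^ 2 * potential d (sqDist H x y) (sumDist H x y))

open Classical in
/-- The preferred neighbour of `x` when the target is `y`. -/
noncomputable def preferred (hH : H.Connected) (x y : Fin d → α) : Fin d → α :=
  if h : x ≠ y then (exists_preferred hH h).choose else x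

open Classical in
theorem boxPotential_hasDrift [Fintype α] (hd : 1 ≤ d) (hH : H.Connected)
    (hdeg : ∀ u, (Finset.univ.filter (H.Adj u)).card ≤ 2) :
    HasDrift (boxPower H d) (preferred hH) (boxPotential H) := by
  refine ⟨fun x => by simp [boxPotential, potential, sqDist_self, sumDist_self], fun x y hxy => ?_⟩
  have hd' : (1 : ℝ) ≤ d := by exact_mod_cast hd
  obtain ⟨A, hadj, hA, hmax, hsq, hsd⟩ := (exists_preferred hH hxy).choose_spec
  have hr : preferred hH x y = (exists_preferred hH hxy).choose := by
    rw [preferred, dif_pos hxy]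
  rw [← hr] at hadj hsq hsd
  set z := preferred hH x y with hzdef
  set N := Finset.univ.filter ((boxPower H d).Adj x) with hNdef
  have hzN : z ∈ N := by simpa [N] using hadj
  have hnonneg : ∀ a : Fin d → α, 0 ≤ sqDist H a y := fun a =>
    Finset.sum_nonneg fun _ _ => by positivity
  -- The squared distance at `z` is nonnegative and smaller by `2A - 1 ≥ 1`.
  have hge : 1 ≤ sqDist H x y := by
    have h1 := hnonneg z
    have h2 : (1 : ℝ) ≤ A := by exact_mod_cast hA
    linarith
  have hm : sumDist H x y ≤ d * A := by
    refine (Finset.sum_le_card_nsmul _ _ A fun i _ => hmax i).trans (by simp)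
  have drift := potential_drift hd N hzN (card_boxPower_adj_le hdeg x) (fun a => sqDist H a y)
    (fun a => sumDist H a y) (sqDist H x y) (sumDist H x y) A hnonneg hge hm
    (sqDist_le_sumDist_sq x y) hA (sum_sqDist_sub_le hH hdeg x y) hsq hsd
  have hcard : 0 < N.card := Finset.card_pos.2 ⟨z, hzN⟩
  have hpot : ∀ s m, 0 ≤ potential d s m := potential_nonneg hd
  rw [lintegral_offerAt _ _ _ hcard]
  have hchoose : ∀ a b : Fin d → α,
      choose (selectTowards (preferred hH)) [y] ⟨x, a, b⟩ = if b = z then b else a := fun a b => by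
    by_cases hb : b = z <;> simp [choose, selectTowards, ← hzdef, hb]
  have hconv : ((N.card : ℝ≥0∞)⁻¹) ^ 2 *
      ∑ a ∈ N, ∑ b ∈ N, boxPotential H (if b = z then b else a) y = ENNReal.ofReal
        (4 * d ^ 2 * (((N.card : ℝ)⁻¹) ^ 2 * ∑ a ∈ N, ∑ b ∈ N,
          potential d (sqDist H (if b = z then b else a) y)
            (sumDist H (if b = z then b else a) y))) := by
    have hinv : (N.card : ℝ≥0∞)⁻¹ = ENNReal.ofReal (N.card : ℝ)⁻¹ := by
      rw [ENNReal.ofReal_inv_of_pos (by exact_mod_cast hcard), ENNReal.ofReal_natCast]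
    rw [hinv, ← ENNReal.ofReal_pow (by positivity), mul_left_comm,
      ENNReal.ofReal_mul (by positivity)]
    congr 1
    rw [Finset.mul_sum, ENNReal.ofReal_sum_of_nonneg fun a _ =>
      mul_nonneg (by positivity) (Finset.sum_nonneg fun b _ => hpot _ _)]
    refine Finset.sum_congr rfl fun a _ => ?_
    rw [Finset.mul_sum, ENNReal.ofReal_sum_of_nonneg fun b _ =>
      mul_nonneg (by positivity) (hpot _ _)]
    rfl
  simp_rw [hchoose]
  rw [← hNdef, hconv, ← ENNReal.ofReal_one, ← ENNReal.ofReal_add zero_le_one ?_]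
  · refine ENNReal.ofReal_le_ofReal ?_
    have := mul_le_mul_of_nonneg_left drift (by positivity : (0 : ℝ) ≤ 4 * d ^ 2)
    rw [mul_sub, mul_one_div_cancel (by positivity)] at this
    linarith
  · exact mul_nonneg (by positivity) (mul_nonneg (by positivity)
      (Finset.sum_nonneg fun a _ => Finset.sum_nonneg fun b _ => hpot _ _))

theorem boxPotential_le (hd : 1 ≤ d) (x y : Fin d → α) :
    boxPotential H x y ≤ ENNReal.ofReal (4 * d ^ 2 * (sumDist H x y + potentialWeight d)) :=
  ENNReal.ofReal_le_ofReal
    (mul_le_mul_of_nonneg_left (potential_le hd (sqDist_le_sumDist_sq x y)) (by positivity))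

end BoxDrift

/-! ### Lower bounds for every strategy -/

section LowerBounds

variable {V : Type*} [Fintype V]

/-- Only `t + 1` positions are seen by time `t`, and `n ≤ 2(n - 1)` for `n ≥ 2`. -/
theorem card_le_two_mul_timeToCover (hV : 2 ≤ Fintype.card V) (ω : ℕ → Obs V) :
    (Fintype.card V : ℝ≥0∞) ≤ 2 * timeToCover ω := by
  simp only [timeToCover, ENNReal.mul_iInf_of_ne two_ne_zero ENNReal.ofNat_ne_top]
  refine le_iInf₂ fun t ht => ?_
  have : Fintype.card V ≤ t + 1 := by
    have hsurj : Function.Surjective fun s : Fin (t + 1) => (ω s).pos := fun y => by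
      obtain ⟨s, hs, h⟩ := ht y
      exact ⟨⟨s, Nat.lt_succ_of_le hs⟩, h⟩
    simpa using Fintype.card_le_of_surjective _ hsurj
  exact_mod_cast (by omega : Fintype.card V ≤ 2 * t)

theorem card_le_two_mul_coverTime (G : SimpleGraph V) (hV : 2 ≤ Fintype.card V) :
    (Fintype.card V : ℝ≥0∞) ≤ 2 * coverTime G := by
  obtain ⟨v⟩ : Nonempty V := Fintype.card_pos_iff.1 (by omega)
  refine le_trans ?_ (mul_le_mul_right (le_iSup (coverTimeFrom G) v) 2)
  rw [coverTimeFrom, ENNReal.mul_iInf_of_ne two_ne_zero ENNReal.ofNat_ne_top]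
  refine le_iInf fun σ => ?_
  rw [← lintegral_const_mul' _ _ ENNReal.ofNat_ne_top]
  calc (Fintype.card V : ℝ≥0∞) = ∫⁻ _, (Fintype.card V : ℝ≥0∞) ∂law G σ v := by simp
    _ ≤ _ := lintegral_mono fun ω => card_le_two_mul_timeToCover hV ω

/-- A function that increases by at most one along edges increases at most linearly in time along
the walk. -/
theorem ae_law_le_add {G : SimpleGraph V} {f : V → ℕ} (hf : ∀ x y, G.Adj x y → f y ≤ f x + 1)
    (σ : Strategy V) (v : V) : ∀ᵐ ω ∂law G σ v, ∀ t, f (ω t).pos ≤ f v + t := by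
  classical
  -- The induction must also control both offers, since the next position is one of them.
  let P : ℕ → Obs V → Prop := fun t o =>
    f o.pos ≤ f v + t ∧ f o.c₁ ≤ f v + t + 1 ∧ f o.c₂ ≤ f v + t + 1
  have hoffer : ∀ t y, f y ≤ f v + t → ∀ o ∈ (offerAt G y).support, P t o := fun t y hy o ho => by
    obtain ⟨h, h1, h2⟩ := mem_support_offerAt ho
    have hstep : ∀ w ∈ (randomNeighbour G y).support, f w ≤ f v + t + 1 := fun w hw => by
      rcases eq_or_adj_of_mem_support_randomNeighbour hw with rfl | h
      · omega
      · have := hf _ _ h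
        omega
    exact ⟨h ▸ hy, hstep _ h1, hstep _ h2⟩
  have key : ∀ t, ∀ᵐ ω ∂law G σ v, P t (ω t) := by
    -- Almost sure statements are recast as vanishing integrals, so that `lintegral_law_zero` and
    -- `lintegral_law_succ` apply.
    have hae : ∀ t, (∫⁻ ω, (if P t (ω t) then 0 else 1 : ℝ≥0∞) ∂law G σ v = 0) →
        ∀ᵐ ω ∂law G σ v, P t (ω t) := fun t h => by
      have hm : Measurable fun ω : ℕ → Obs V => (if P t (ω t) then 0 else 1 : ℝ≥0∞) :=
        (Measurable.of_discrete (f := fun o => (if P t o then 0 else 1 : ℝ≥0∞))).comp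
          (measurable_pi_apply t)
      filter_upwards [(lintegral_eq_zero_iff hm).1 h] with ω hω
      by_contra hc
      simp [hc] at hω
    intro t
    induction t with
    | zero =>
      refine hae 0 ?_
      rw [lintegral_law_zero G σ v fun o => if P 0 o then 0 else 1]
      refine (lintegral_congr_ae ?_).trans lintegral_zero
      exact (ae_toMeasure_iff _ _).2 fun o ho => if_pos (hoffer 0 v le_rfl o ho)
    | succ t ih =>
      refine hae (t + 1) ?_
      rw [lintegral_law_succ G σ v t fun _ o => if P (t + 1) o then 0 else 1]
      refine (lintegral_congr_ae ?_).trans lintegral_zero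
      filter_upwards [ih] with ω hω
      refine (lintegral_congr_ae ?_).trans lintegral_zero
      refine (ae_toMeasure_iff _ _).2 fun o ho => if_pos ?_
      simp only [nextObs, nextPos, PMF.mem_support_bind_iff, PMF.mem_support_map_iff] at ho
      obtain ⟨y, ⟨b, -, rfl⟩, ho⟩ := ho
      refine hoffer (t + 1) _ ?_ o ho
      cases b
      · exact hω.2.2
      · exact hω.2.1
  filter_upwards [ae_all_iff.2 key] with ω hω t
  exact (hω t).1

theorem le_hittingTimeFrom {G : SimpleGraph V} {f : V → ℕ}
    (hf : ∀ x y, G.Adj x y → f y ≤ f x + 1) {x y : V} (hx : f x = 0) :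
    (f y : ℝ≥0∞) ≤ hittingTimeFrom G x y := by
  refine le_iInf fun σ => ?_
  calc (f y : ℝ≥0∞) = ∫⁻ _, (f y : ℝ≥0∞) ∂law G σ x := by simp
    _ ≤ _ := lintegral_mono_ae ?_
  filter_upwards [ae_law_le_add hf σ x] with ω hω
  refine le_iInf₂ fun t ht => ?_
  have := hω t
  rw [ht, hx, zero_add] at this
  exact_mod_cast this

end LowerBounds

/-! ### The torus and the grid -/

theorem boxPower_mono {α : Type*} {H H' : SimpleGraph α} (h : H ≤ H') (d : ℕ) :
    boxPower H d ≤ boxPower H' d :=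
  fun _ _ ⟨i, hi, hj⟩ => ⟨i, h hi, hj⟩

/-- The cyclic distance to zero changes by at most one along an edge of the cycle. -/
theorem min_val_le_of_cycleGraph_adj {k : ℕ} {u v : Fin k}
    (h : (SimpleGraph.cycleGraph k).Adj u v) :
    min v.val (k - v.val) ≤ min u.val (k - u.val) + 1 := by
  rw [SimpleGraph.cycleGraph_adj'] at h
  simp only [Fin.sub_def] at h
  have hu := u.isLt
  have hv := v.isLt
  rcases h with h | h
  · rcases le_or_gt v.val u.val with hle | hlt
    · rw [show k - v.val + u.val = (u.val - v.val) + k by omega, Nat.add_mod_right,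
        Nat.mod_eq_of_lt (by omega)] at h
      omega
    · rw [Nat.mod_eq_of_lt (by omega)] at h
      omega
  · rcases le_or_gt u.val v.val with hle | hlt
    · rw [show k - u.val + v.val = (v.val - u.val) + k by omega, Nat.add_mod_right,
        Nat.mod_eq_of_lt (by omega)] at h
      omega
    · rw [Nat.mod_eq_of_lt (by omega)] at h
      omega

/-- The test function is the cyclic distance to zero in the first coordinate. It is Lipschitz on the
torus, hence on every subgraph, which includes the grid. -/
theorem le_three_mul_hittingTime {d k : ℕ} (hd : 1 ≤ d) (hk : 2 ≤ k)
    {G : SimpleGraph (Fin d → Fin k)} (hG : G ≤ torus d k) :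
    (k : ℝ≥0∞) ≤ 3 * hittingTime G := by
  let f : (Fin d → Fin k) → ℕ := fun x => min (x ⟨0, hd⟩).val (k - (x ⟨0, hd⟩).val)
  have hf : ∀ x y, G.Adj x y → f y ≤ f x + 1 := fun x y h => by
    obtain ⟨i, hi, hj⟩ := hG h
    by_cases h0 : ⟨0, hd⟩ = i
    · subst h0
      exact min_val_le_of_cycleGraph_adj hi
    · simp only [f, hj _ h0]
      omega
  have hlow := le_hittingTimeFrom hf (x := fun _ => ⟨0, by omega⟩)
    (y := fun _ => ⟨k / 2, by omega⟩) (by simp [f])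
  have hsup := le_iSup₂ (f := hittingTimeFrom G) (fun _ => ⟨0, by omega⟩)
    (fun _ => ⟨k / 2, by omega⟩)
  refine le_trans ?_ (mul_le_mul_right (hlow.trans hsup) 3)
  -- The factor three is sharp at `k = 3`, where `k / 2` rounds down to one.
  have : k ≤ 3 * min (k / 2) (k - k / 2) := by omega
  exact_mod_cast this

open Classical in
theorem card_cycleGraph_adj_le {k : ℕ} (hk : 2 ≤ k) (u : Fin k) :
    (Finset.univ.filter ((SimpleGraph.cycleGraph k).Adj u)).card ≤ 2 := by
  obtain ⟨n, rfl⟩ := Nat.exists_eq_add_of_le' hk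
  refine (Finset.card_le_card (t := {u - 1, u + 1}) fun w hw => ?_).trans Finset.card_le_two
  have : w ∈ (SimpleGraph.cycleGraph (n + 2)).neighborSet u := by simpa using hw
  rw [SimpleGraph.cycleGraph_neighborSet] at this
  simpa using this

theorem dist_le_card {α : Type*} [Fintype α] {H : SimpleGraph α} (hH : H.Connected) (u v : α) :
    H.dist u v ≤ Fintype.card α := by
  obtain ⟨p, hp, hl⟩ := hH.exists_path_of_dist u v
  exact hl ▸ hp.length_lt.le

/-- The constant in the upper bounds. -/
noncomputable def boxConstant (d : ℕ) : ℝ := 8 * d ^ 2 * (d + potentialWeight d)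

open Classical in
theorem hittingTime_boxPower_le {α : Type*} [Fintype α] {H : SimpleGraph α} {d : ℕ} (hd : 1 ≤ d)
    (hH : H.Connected) (hdeg : ∀ u, (Finset.univ.filter (H.Adj u)).card ≤ 2) :
    hittingTime (boxPower H d) ≤ ENNReal.ofReal (boxConstant d) * Fintype.card α := by
  refine iSup₂_le fun x y => ((boxPotential_hasDrift hd hH hdeg).hittingTimeFrom_le x y).trans
    ((boxPotential_le hd x y).trans ?_)
  have := hH.nonempty
  have hW := potentialWeight_pos hd
  have hk : (1 : ℝ) ≤ Fintype.card α := by exact_mod_cast Fintype.card_pos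
  have hsum : sumDist H x y ≤ d * Fintype.card α :=
    (Finset.sum_le_card_nsmul _ _ _ fun i _ => dist_le_card hH (x i) (y i)).trans (by simp)
  have hsum' : (sumDist H x y : ℝ) ≤ d * Fintype.card α := by exact_mod_cast hsum
  rw [← ENNReal.ofReal_natCast, ← ENNReal.ofReal_mul (by unfold boxConstant; positivity)]
  refine ENNReal.ofReal_le_ofReal ?_
  have h1 : sumDist H x y + potentialWeight d ≤ (d + potentialWeight d) * Fintype.card α := by
    nlinarith
  calc 4 * (d : ℝ) ^ 2 * (sumDist H x y + potentialWeight d)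
      ≤ 4 * d ^ 2 * ((d + potentialWeight d) * Fintype.card α) := by gcongr
    -- The extra factor two is not needed here; it comes from the tour length `2n`, so that one
    -- constant serves both upper bounds.
    _ ≤ 8 * d ^ 2 * ((d + potentialWeight d) * Fintype.card α) := by gcongr; norm_num
    _ = boxConstant d * Fintype.card α := by unfold boxConstant; ring

open Classical in
theorem coverTime_boxPower_le {α : Type*} [Fintype α] {H : SimpleGraph α} {d : ℕ} (hd : 1 ≤ d)
    (hH : H.Connected) (hdeg : ∀ u, (Finset.univ.filter (H.Adj u)).card ≤ 2) :
    coverTime (boxPower H d) ≤ ENNReal.ofReal (boxConstant d) * Fintype.card (Fin d → α) := by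
  have hd' : (1 : ℝ) ≤ d := by exact_mod_cast hd
  have hM : ∀ x y, (boxPower H d).Adj x y → boxPotential H x y ≤
      ENNReal.ofReal (4 * d ^ 2 * (d + potentialWeight d)) := fun x y h => by
    refine (boxPotential_le hd x y).trans (ENNReal.ofReal_le_ofReal ?_)
    rw [sumDist_of_adj h, Nat.cast_one]
    gcongr
  refine ((boxPotential_hasDrift hd hH hdeg).coverTime_le (boxPower_connected hH d) hM).trans
    (le_of_eq ?_)
  rw [boxConstant, show 8 * (d : ℝ) ^ 2 * (d + potentialWeight d) =
    2 * (4 * d ^ 2 * (d + potentialWeight d)) by ring, ENNReal.ofReal_mul two_pos.le,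
    ENNReal.ofReal_ofNat]
  ring

end ChoiceWalk

theorem theorem5p3 (d : ℕ) (hd : 1 ≤ d) :
    ∃ c C : ℝ≥0, 0 < c ∧
      ∀ (k : ℕ), 2 ≤ k → ∀ G : SimpleGraph (Fin d → Fin k),
        (G = ChoiceWalk.torus d k ∨ G = ChoiceWalk.grid d k) →
        ((c : ℝ≥0∞) * (Fintype.card (Fin d → Fin k) : ℝ≥0∞) ≤ ChoiceWalk.coverTime G ∧
          ChoiceWalk.coverTime G ≤ (C : ℝ≥0∞) * (Fintype.card (Fin d → Fin k) : ℝ≥0∞)) ∧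
        ((c : ℝ≥0∞) * (k : ℝ≥0∞) ≤ ChoiceWalk.hittingTime G ∧
          ChoiceWalk.hittingTime G ≤ (C : ℝ≥0∞) * (k : ℝ≥0∞)) ∧
        ChoiceWalk.hittingTime G ≤
          (C : ℝ≥0∞) * (Fintype.card (Fin d → Fin k) : ℝ≥0∞) ^ (1 / (d : ℝ)) := by
  classical
  -- The hitting bound dictates `3⁻¹`; covering alone would allow one half.
  refine ⟨3⁻¹, (ChoiceWalk.boxConstant d).toNNReal, by positivity, fun k hk G hG => ?_⟩
  obtain ⟨n, rfl⟩ := Nat.exists_eq_add_of_le' hk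
  -- The path is a subgraph of the cycle, so both cases reduce to a connected factor inside the
  -- cycle, which inherits the degree bound.
  obtain ⟨H, hle, hH, rfl⟩ : ∃ H, H ≤ SimpleGraph.cycleGraph (n + 2) ∧ H.Connected ∧
      G = ChoiceWalk.boxPower H d := by
    rcases hG with rfl | rfl
    · exact ⟨_, le_rfl, SimpleGraph.cycleGraph_connected, rfl⟩
    · exact ⟨_, SimpleGraph.pathGraph_le_cycleGraph, SimpleGraph.pathGraph_connected _, rfl⟩
  have hdeg : ∀ u, (Finset.univ.filter (H.Adj u)).card ≤ 2 := fun u =>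
    (Finset.card_le_card (Finset.monotone_filter_right _ fun _ _ h => hle h)).trans
      (ChoiceWalk.card_cycleGraph_adj_le hk u)
  have hhit : ChoiceWalk.hittingTime (ChoiceWalk.boxPower H d) ≤
      ((ChoiceWalk.boxConstant d).toNNReal : ℝ≥0∞) * (n + 2 : ℕ) := by
    have h := ChoiceWalk.hittingTime_boxPower_le hd hH hdeg
    rw [Fintype.card_fin] at h
    exact h
  have hc3 : ((3⁻¹ : ℝ≥0) : ℝ≥0∞) = 3⁻¹ := by simp
  have hcard : 2 ≤ Fintype.card (Fin d → Fin (n + 2)) := by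
    rw [Fintype.card_fun, Fintype.card_fin, Fintype.card_fin]
    exact hk.trans (Nat.le_self_pow (by omega) _)
  refine ⟨⟨?_, ChoiceWalk.coverTime_boxPower_le hd hH hdeg⟩, ⟨?_, hhit⟩, ?_⟩
  · rw [hc3, ENNReal.inv_mul_le_iff three_ne_zero ENNReal.ofNat_ne_top]
    refine (ChoiceWalk.card_le_two_mul_coverTime (ChoiceWalk.boxPower H d) hcard).trans ?_
    gcongr
    norm_num
  · rw [hc3, ENNReal.inv_mul_le_iff three_ne_zero ENNReal.ofNat_ne_top]
    exact ChoiceWalk.le_three_mul_hittingTime hd hk (ChoiceWalk.boxPower_mono hle d)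
  · convert hhit using 2
    rw [Fintype.card_fun, Fintype.card_fin, Fintype.card_fin, Nat.cast_pow, ← ENNReal.rpow_natCast,
      ← ENNReal.rpow_mul, mul_one_div_cancel (by exact_mod_cast (by omega : d ≠ 0)),
      ENNReal.rpow_one]
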